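/- Let $X$ be a metric space. A finite family $U_1,\dots,U_n$ ($n\ge 0$) of subsets of $U\subseteq X$ is a \emph{coarse cover} of $U$ if for every $E\subseteq U\times U$ with $\sup_{(x,y)\in E}d(x,y)<\infty$ the set $\bigcap_{i=1}^n E[U\setminus U_i]$ is bounded, where $E[B]=\{x: (x,y)\in E\text{ for some }y\in B\}$ and the intersection is formed inside $U$ (so that the empty family covers exactly the bounded sets). The poset of subsets of $X$, with the Grothendieck topology whose coverings are the coarse covers, is a site $X_{ct}$. For an abelian group $A$, let $A_X$ be the constant sheaf on $X_{ct}$ (the sheafification of the constant presheaf $A$), and let $\check H^q_{ct}(X;A)$ be the value at $A_X$ of the $q$-th right derived functor of the global sections functor $\mathcal F\mapsto\mathcal F(X)$ on abelian sheaves on $X_{ct}$. \textbf{Theorem.} Let $T$ be a tree, regarded as a metric space; that is, let $T$ be either a real tree (any two points are joined by a unique geodesic segment, and two geodesic segments $[x,y]$, $[y,z]$ with $[x,y]\cap[y,z]=\{y\}$ have a geodesic segment from $x$ to $z$ as their union; for example, the geometric realization of a simplicial tree with edges of length $1$), or the vertex set of a combinatorial tree with the path metric. No local finiteness is assumed. If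 $A$ is a finite abelian group, then \[ \check H^1_{ct}(T;A)=0 . \] -/

import Mathlib

open CategoryTheory Opposite

universe u

namespace CoarseSheaf

section Coarse

variable {X : Type u} [MetricSpace X]

/-- A subset `E` of `X × X` is an entourage if the distance is bounded on `E`. -/
def IsEntourage (E : Set (X × X)) : Prop :=
  ∃ R : ℝ, ∀ p ∈ E, dist p.1 p.2 ≤ R

/-- The thickening `E[B]`, the set of all `x` with `(x, y) ∈ E` for some `y ∈ B`. -/
def thicken (E : Set (X × X)) (B : Set X) : Set X :=
  {x | ∃ y ∈ B, (x, y) ∈ E}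

/-- The finite family `V` of subsets of `U` is a coarse cover of `U`: for every entourage
`E` of `U`, the intersection of all `E[U \ V i]` is bounded. The intersection is taken inside `U`,
so the empty family covers exactly the bounded sets. -/
def IsCoarseCover {n : ℕ} (U : Set X) (V : Fin n → Set X) : Prop :=
  (∀ i, V i ⊆ U) ∧
    ∀ E : Set (X × X), E ⊆ U ×ˢ U → IsEntourage E →
      Bornology.IsBounded (U ∩ ⋂ i, thicken E (U \ V i))

/-- A coarse cover of `U` restricts to a coarse cover of every subset of `U`. -/
theorem IsCoarseCover.restrict {n : ℕ} {U W : Set X} {V : Fin n → Set X}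
    (h : IsCoarseCover U V) (hW : W ⊆ U) : IsCoarseCover W (fun i => V i ∩ W) := by
  refine ⟨fun i => Set.inter_subset_right, fun E hE hb => ?_⟩
  refine (h.2 E (hE.trans (Set.prod_mono hW hW)) hb).subset ?_
  rintro x ⟨hx, hxi⟩
  refine ⟨hW hx, Set.mem_iInter.2 fun i => ?_⟩
  obtain ⟨y, hy, hxy⟩ := Set.mem_iInter.1 hxi i
  exact ⟨y, ⟨hW hy.1, fun hyV => hy.2 ⟨hyV, hy.1⟩⟩, hxy⟩

/-- The one-member family `U` is a coarse cover of `U`. -/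
theorem isCoarseCover_self (U : Set X) : IsCoarseCover U (fun _ : Fin 1 => U) := by
  refine ⟨fun _ => subset_rfl, fun E _ _ => ?_⟩
  refine Bornology.isBounded_empty.subset ?_
  rintro x ⟨_, hx⟩
  obtain ⟨y, hy, _⟩ := Set.mem_iInter.1 hx 0
  exact hy.2 hy.1

/-- Coarse covers of the members of a coarse cover combine to a coarse cover: any family that
runs through all members of the given covers of the `V i` is a coarse cover. -/
theorem IsCoarseCover.trans {n : ℕ} {U : Set X} {V : Fin n → Set X} (h : IsCoarseCover U V)
    {m : Fin n → ℕ} {W : ∀ i, Fin (m i) → Set X} (hW : ∀ i, IsCoarseCover (V i) (W i))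
    {N : ℕ} (e : Fin N ≃ Σ i, Fin (m i)) :
    IsCoarseCover U (fun k => W (e k).1 (e k).2) := by
  refine ⟨fun k => ((hW _).1 _).trans (h.1 _), fun E hE hb => ?_⟩
  obtain ⟨R, hR⟩ := hb
  have key : U ∩ ⋂ k, thicken E (U \ W (e k).1 (e k).2) ⊆
      (U ∩ ⋂ i, thicken ((U ×ˢ U) ∩ {p | dist p.1 p.2 ≤ max R 0}) (U \ V i)) ∪
        ⋃ i, (V i ∩ ⋂ j, thicken ((V i ×ˢ V i) ∩ {p | dist p.1 p.2 ≤ R}) (V i \ W i j)) := by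
    rintro x ⟨hxU, hx⟩
    by_cases hc : ∃ i, ∀ y ∈ U, dist x y ≤ max R 0 → y ∈ V i
    · right
      obtain ⟨i, hi⟩ := hc
      have hxV : x ∈ V i := hi x hxU (by simp)
      refine Set.mem_iUnion.2 ⟨i, hxV, Set.mem_iInter.2 fun j => ?_⟩
      have hx' := Set.mem_iInter.1 hx (e.symm ⟨i, j⟩)
      rw [e.apply_symm_apply] at hx'
      obtain ⟨y, hy, hxy⟩ := hx'
      have hd := hR _ hxy
      have hyV := hi y hy.1 (hd.trans (le_max_left _ _))
      exact ⟨y, ⟨hyV, hy.2⟩, ⟨hxV, hyV⟩, hd⟩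
    · left
      push Not at hc
      refine ⟨hxU, Set.mem_iInter.2 fun i => ?_⟩
      obtain ⟨y, hyU, hd, hyV⟩ := hc i
      exact ⟨y, ⟨hyU, hyV⟩, ⟨hxU, hyU⟩, hd⟩
  refine Bornology.IsBounded.subset (Bornology.IsBounded.union ?_ ?_) key
  · exact h.2 _ Set.inter_subset_left ⟨max R 0, fun p hp => hp.2⟩
  · exact (Bornology.isBounded_iUnion).2 fun i =>
      (hW i).2 _ Set.inter_subset_left ⟨R, fun p hp => hp.2⟩

variable (X) in
/-- The site `X_ct`: the category is the poset of subsets of `X`, and a sieve on `U` is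
covering if it contains all members of some (finite) coarse cover of `U`. -/
def coarseTopology : GrothendieckTopology (Set X) where
  sieves U := {S | ∃ (n : ℕ) (V : Fin n → Set X),
    IsCoarseCover U V ∧ ∀ i, ∃ f : V i ⟶ U, S f}
  top_mem' U := ⟨1, fun _ => U, isCoarseCover_self U, fun _ => ⟨𝟙 U, trivial⟩⟩
  pullback_stable' := by
    rintro U W S g ⟨n, V, hV, hS⟩
    refine ⟨n, fun i => V i ∩ W, hV.restrict (leOfHom g), fun i => ?_⟩
    obtain ⟨f, hf⟩ := hS i
    exact ⟨homOfLE Set.inter_subset_right,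
      S.downward_closed hf (homOfLE (Set.inter_subset_left (s := V i) (t := W)))⟩
  transitive' := by
    rintro U S ⟨n, V, hV, hS⟩ S' h
    choose f hf using hS
    choose m W hW hW' using fun i => h (hf i)
    refine ⟨_, _, hV.trans hW finSigmaFinEquiv.symm, fun k => ?_⟩
    obtain ⟨g, hg⟩ := hW' (finSigmaFinEquiv.symm k).1 (finSigmaFinEquiv.symm k).2
    exact ⟨_, hg⟩

end Coarse

noncomputable section Cohomology

variable (X : Type u) [MetricSpace X]

/-- The global sections functor `F ↦ F(X)` on abelian sheaves on `X_ct`. -/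
abbrev globalSections : Sheaf (coarseTopology X) AddCommGrpCat.{u} ⥤ AddCommGrpCat.{u} :=
  sheafToPresheaf (coarseTopology X) AddCommGrpCat.{u} ⋙
    (evaluation (Set X)ᵒᵖ AddCommGrpCat.{u}).obj (op Set.univ)

/-- The constant sheaf `A_X` on `X_ct`, the sheafification of the constant presheaf `A`. -/
abbrev constSheaf (A : Type u) [AddCommGroup A] : Sheaf (coarseTopology X) AddCommGrpCat.{u} :=
  (constantSheaf (coarseTopology X) AddCommGrpCat.{u}).obj (AddCommGrpCat.of A)

/-- Coarse sheaf cohomology with constant coefficients: the `q`-th right derived functor of the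
global sections functor, applied to the constant sheaf `A_X`. -/
def coarseCohomology (A : Type u) [AddCommGroup A] (q : ℕ) : AddCommGrpCat.{u} :=
  ((globalSections X).rightDerived q).obj (constSheaf X A)

end Cohomology

section Tree

variable {T : Type u} [MetricSpace T]

/-- `S` is a geodesic segment from `x` to `y`: the image of an isometric embedding
of the interval `[0, dist x y]` that starts at `x` and ends at `y`. -/
def IsGeodesicSegment (S : Set T) (x y : T) : Prop :=
  ∃ γ : ℝ → T, γ 0 = x ∧ γ (dist x y) = y ∧
    (∀ s ∈ Set.Icc 0 (dist x y), ∀ t ∈ Set.Icc 0 (dist x y), dist (γ s) (γ t) = |s - t|) ∧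
    S = γ '' Set.Icc 0 (dist x y)

variable (T)

/-- Real trees: any two points are joined by a unique geodesic segment, and two segments that
meet only in a common endpoint fit together to a segment. The geometric realization of a simplicial
tree, with its path metric, is a real tree. -/
structure IsRealTree : Prop where
  existsUnique_segment : ∀ x y : T, ∃! S : Set T, IsGeodesicSegment S x y
  concat : ∀ (x y z : T) (S S' : Set T), IsGeodesicSegment S x y → IsGeodesicSegment S' y z →
    S ∩ S' = {y} → IsGeodesicSegment (S ∪ S') x z

/-- `T` is the vertex set of a combinatorial tree, with the path metric. -/
def IsVertexTree : Prop :=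
  ∃ G : SimpleGraph T, G.IsTree ∧ ∀ x y : T, dist x y = G.dist x y

/-- A tree as a metric space: a real tree, or the set of vertices of a combinatorial tree. There is
no condition of local finiteness. -/
def IsMetricTree : Prop :=
  IsRealTree T ∨ IsVertexTree T

end Tree

end CoarseSheaf

/-! Take an injective resolution I of the constant sheaf. A global section s of I¹ with ds = 0 lifts
to sections t_i of I⁰ on a coarse cover V_i. On V_i ∩ V_j the difference t_i - t_j comes from the
constant sheaf: it is given by a function f_ij to A that does not vary at bounded scales far out
(`exists_function_of_imageSieve_mem`). The f_ij satisfy the Čech cocycle identity off a bounded set,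
since distinct constants give distinct sections on unbounded sets.

Such a cocycle yields a function c with c(x, y) + c(y, z) = c(x, z) for far points at bounded
distance (`IsCoarselyAcyclic.exists_coboundary`). In a tree, let h(x) be the sum of c along steps of
length at most 1 from x to a root. Two points at distance at most R have ancestral lines that merge
within a number of steps depending only on R, so the common tails cancel and c(x, y) = h(x) - h(y)
far out (`isCoarselyAcyclic_of_parent`). Branching degrees never enter, so local finiteness plays no
role.

Hence f_ij = e_j - e_i with e_i coarsely locally constant. As A is finite, cutting the V_i by the
values of e_i leaves a finite coarse cover, on which the t_i + e_i glue to a lift of s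
(`IsCoarselyAcyclic.exists_lift`). -/

namespace CoarseSheaf

/-! ### Exact sequences of sheaves and the first derived functor -/

section ExactSheaves

variable {C : Type u} [Category.{u} C] {J : GrothendieckTopology C}

/-- An exact sequence of abelian sheaves is locally exact on sections. -/
theorem imageSieve_mem_of_exact {S : ShortComplex (Sheaf J AddCommGrpCat.{u})} (hS : S.Exact)
    {U : C} (t : S.X₂.obj.obj (op U)) (ht : S.g.hom.app (op U) t = 0) :
    Presheaf.imageSieve S.f.hom t ∈ J U := by
  let Γ : Sheaf J AddCommGrpCat.{u} ⥤ AddCommGrpCat.{u} :=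
    sheafToPresheaf J AddCommGrpCat.{u} ⋙ (evaluation Cᵒᵖ AddCommGrpCat.{u}).obj (op U)
  let S' : ShortComplex (Sheaf J AddCommGrpCat.{u}) := ShortComplex.mk S.iCycles S.g (by simp)
  have hS' : S'.Exact := ShortComplex.exact_of_f_is_kernel _ S.cyclesIsKernel
  have hΓ : (S'.map Γ).Exact :=
    hS'.map_of_mono_of_preservesKernel Γ (inferInstanceAs (Mono S.iCycles)) inferInstance
  obtain ⟨z, hz⟩ : ∃ z : S.cycles.obj.obj (op U), S.iCycles.hom.app (op U) z = t :=
    (ShortComplex.ab_exact_iff _).1 hΓ t ht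
  -- Sections of the kernel sheaf are computed objectwise, so only the epimorphism onto it needs a
  -- refinement of U.
  have hepi : Epi S.toCycles := S.exact_iff_epi_toCycles.1 hS
  have hls : Sheaf.IsLocallySurjective S.toCycles :=
    (Sheaf.isLocallySurjective_iff_epi' AddCommGrpCat.{u} S.toCycles).2 hepi
  refine J.superset_covering ?_ (hls.imageSieve_mem (U := U) z)
  rintro V i ⟨w, hw⟩
  refine ⟨w, ?_⟩
  have h1 : S.f.hom = S.toCycles.hom ≫ S.iCycles.hom := by
    rw [← ObjectProperty.FullSubcategory.comp_hom, S.toCycles_i]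
  rw [h1, NatTrans.comp_app, ConcreteCategory.comp_apply, hw, NatTrans.naturality_apply, hz]

end ExactSheaves

section Derived

variable (X : Type u) [MetricSpace X]

theorem isZero_rightDerived_one {F : Sheaf (coarseTopology X) AddCommGrpCat.{u}}
    (I : InjectiveResolution F)
    (h : ∀ s : (I.cocomplex.X 1).obj.obj (op Set.univ),
      (I.cocomplex.d 1 2).hom.app (op Set.univ) s = 0 →
        ∃ t : (I.cocomplex.X 0).obj.obj (op Set.univ),
          (I.cocomplex.d 0 1).hom.app (op Set.univ) t = s) :
    Limits.IsZero (((globalSections X).rightDerived 1).obj F) := by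
  refine Limits.IsZero.of_iso ?_ (I.isoRightDerivedObj (globalSections X) 1)
  refine (HomologicalComplex.exactAt_iff_isZero_homology _ 1).1 ?_
  refine (HomologicalComplex.exactAt_iff' _ 0 1 2 (by simp) (by simp)).2 ?_
  exact (ShortComplex.ab_exact_iff _).2 h

end Derived

/-! ### The constant sheaf seen through the constant presheaf -/

section Const

variable (X : Type u) [MetricSpace X] (A : Type u) [AddCommGroup A]

/-- The constant presheaf with value `A`. -/
abbrev constPresheaf : (Set X)ᵒᵖ ⥤ AddCommGrpCat.{u} :=
  (Functor.const _).obj (AddCommGrpCat.of A)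

variable {X A}

variable (X A) in
/-- The map from the constant presheaf to the constant sheaf. -/
noncomputable def toConstSheaf : constPresheaf X A ⟶ (constSheaf X A).obj :=
  toSheafify (coarseTopology X) (constPresheaf X A)

instance : Presheaf.IsLocallyInjective (coarseTopology X) (toConstSheaf X A) :=
  inferInstanceAs (Presheaf.IsLocallyInjective (coarseTopology X)
    (toSheafify (coarseTopology X) (constPresheaf X A)))

instance : Presheaf.IsLocallySurjective (coarseTopology X) (toConstSheaf X A) :=
  inferInstanceAs (Presheaf.IsLocallySurjective (coarseTopology X)
    (toSheafify (coarseTopology X) (constPresheaf X A)))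

variable {F₀ : Sheaf (coarseTopology X) AddCommGrpCat.{u}} (η : constSheaf X A ⟶ F₀)

/-- The map of presheaves from the constant presheaf that corresponds to a map from the constant
sheaf. -/
noncomputable def constPresheafMap : constPresheaf X A ⟶ F₀.obj :=
  toConstSheaf X A ≫ η.hom

theorem constPresheafMap_comp {F₁ : Sheaf (coarseTopology X) AddCommGrpCat.{u}} {d : F₀ ⟶ F₁}
    (w : η ≫ d = 0) : constPresheafMap η ≫ d.hom = 0 := by
  have h : η.hom ≫ d.hom = 0 := by
    rw [← ObjectProperty.FullSubcategory.comp_hom, w]; rfl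
  rw [constPresheafMap, Category.assoc, h, Limits.comp_zero]

theorem constPresheafMap_isLocallyInjective [Mono η] :
    Presheaf.IsLocallyInjective (coarseTopology X) (constPresheafMap η) := by
  have h : Presheaf.IsLocallyInjective (coarseTopology X) η.hom := by
    refine Presheaf.isLocallyInjective_of_injective _ _ fun U => ?_
    let Γ : Sheaf (coarseTopology X) AddCommGrpCat.{u} ⥤ AddCommGrpCat.{u} :=
      sheafToPresheaf _ _ ⋙ (evaluation (Set X)ᵒᵖ AddCommGrpCat.{u}).obj U
    exact (AddCommGrpCat.mono_iff_injective (Γ.map η)).1 inferInstance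
  exact Presheaf.isLocallyInjective_comp (coarseTopology X) (toConstSheaf X A) η.hom

/-- Two refinements compose: one from exactness, to reach the constant sheaf, and one to replace its
sections by elements of A. -/
theorem imageSieve_constPresheafMap_mem {F₁ : Sheaf (coarseTopology X) AddCommGrpCat.{u}}
    {d : F₀ ⟶ F₁} {w : η ≫ d = 0} (hex : (ShortComplex.mk η d w).Exact) {U : Set X}
    (t : F₀.obj.obj (op U)) (ht : d.hom.app (op U) t = 0) :
    Presheaf.imageSieve (constPresheafMap η) t ∈ coarseTopology X U := by
  refine (coarseTopology X).transitive (imageSieve_mem_of_exact hex t ht) _ ?_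
  rintro V i ⟨w, hw⟩
  refine (coarseTopology X).superset_covering ?_ (Presheaf.imageSieve_mem (coarseTopology X)
    (toConstSheaf X A) (U := op V) w)
  rintro W j ⟨a, ha⟩
  refine ⟨a, ?_⟩
  rw [constPresheafMap, NatTrans.comp_app, ConcreteCategory.comp_apply, ha,
    op_comp, Functor.map_comp, ConcreteCategory.comp_apply]
  exact (NatTrans.naturality_apply η.hom j.op w).trans (congrArg _ hw)

end Const

/-! ### Coarse acyclicity from merging orbits; vertex trees -/

section Tree

variable {T : Type u} [MetricSpace T] {A : Type u} [AddCommGroup A]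

/-- Every coarse `1`-cocycle with values in `A` is coarsely a coboundary. -/
def IsCoarselyAcyclic (T : Type u) [MetricSpace T] (A : Type u) [AddCommGroup A] : Prop :=
  ∀ c : T → T → A,
    (∀ R : ℝ, ∃ K : Set T, Bornology.IsBounded K ∧ ∀ x ∉ K, ∀ y ∉ K, ∀ z ∉ K,
      dist x y ≤ R → dist y z ≤ R → dist x z ≤ R → c x y + c y z = c x z) →
    ∃ h : T → A, ∀ R : ℝ, ∃ K : Set T, Bornology.IsBounded K ∧ ∀ x ∉ K, ∀ y ∉ K,
      dist x y ≤ R → c x y = h x - h y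

theorem dist_iterate_le {p : T → T} (hp : ∀ x, dist x (p x) ≤ 1) (j : ℕ) (x : T) :
    dist x (p^[j] x) ≤ j := by
  induction j with
  | zero => simp
  | succ j ih =>
    rw [Function.iterate_succ_apply']
    push_cast
    linarith [dist_triangle x (p^[j] x) (p (p^[j] x)), hp (p^[j] x)]

/-- A space in which orbits of a self-map, which moves points by at most `1` towards a base point,
merge within a number of steps controlled by the distance, is coarsely acyclic. -/
theorem isCoarselyAcyclic_of_parent (o : T) (p : T → T) (n : T → ℕ)
    (hp : ∀ x, dist x (p x) ≤ 1) (hn : ∀ x, 1 < dist x o → n x = n (p x) + 1)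
    (hmerge : ∀ R : ℝ, ∃ N : ℕ, ∀ x y : T, dist x y ≤ R →
      ∃ m ≤ N, ∃ l ≤ N, p^[m] x = p^[l] y) :
    IsCoarselyAcyclic T A := by
  intro c hc
  let h : T → A := fun x => ∑ j ∈ Finset.range (n x), c (p^[j] x) (p^[j + 1] x)
  have hstep : ∀ x, 1 < dist x o → h x - h (p x) = c x (p x) := by
    intro x hx
    simp only [h]
    rw [hn x hx, Finset.sum_range_succ']
    simp [Function.iterate_succ_apply]
  refine ⟨h, fun R => ?_⟩
  obtain ⟨N, hN⟩ := hmerge R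
  -- This scale admits the triangle x, y, p^[m] x as well as the triangles x, p^[j] x, p^[j + 1] x.
  obtain ⟨K, hK, hcK⟩ := hc (max R (N + 1))
  obtain ⟨r, hr⟩ := hK.subset_closedBall o
  -- From outside this ball, N + 1 steps can neither reach K nor come within distance 1 of `o`,
  -- where `hn` fails to apply.
  refine ⟨Metric.closedBall o (max r 1 + (N + 1)), Metric.isBounded_closedBall, ?_⟩
  have hfar : ∀ x ∉ Metric.closedBall o (max r 1 + (N + 1)), ∀ j ≤ N + 1,
      p^[j] x ∉ K ∧ 1 < dist (p^[j] x) o := by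
    intro x hx j hj
    rw [Metric.mem_closedBall, not_le] at hx
    have h1 := dist_iterate_le hp j x
    have h2 : (j : ℝ) ≤ N + 1 := by exact_mod_cast hj
    have h3 := dist_triangle x (p^[j] x) o
    have h4 := le_max_left r 1
    have h5 := le_max_right r 1
    refine ⟨fun hjK => ?_, by linarith⟩
    have := Metric.mem_closedBall.1 (hr hjK)
    linarith
  have horbit : ∀ x ∉ Metric.closedBall o (max r 1 + (N + 1)), ∀ j ≤ N,
      c x (p^[j] x) = h x - h (p^[j] x) := by
    intro x hx j
    have hR := le_max_right R ((N : ℝ) + 1)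
    have hxK : x ∉ K := (hfar x hx 0 (by omega)).1
    induction j with
    | zero =>
      intro _
      -- The identity at (x, x, x) forces c x x = 0.
      have := hcK x hxK x hxK x hxK
      simp only [dist_self] at this
      have h0 := this (by positivity) (by positivity) (by positivity)
      simpa using h0
    | succ j ih =>
      intro hj
      have hj' : (j : ℝ) + 1 ≤ N := by exact_mod_cast hj
      have d1 := dist_iterate_le hp j x
      have d2 := dist_iterate_le hp (j + 1) x
      push_cast at d2
      rw [Function.iterate_succ_apply'] at d2 ⊢
      have h1 := hcK x hxK _ (hfar x hx j (by omega)).1 (p (p^[j] x))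
        (by rw [← Function.iterate_succ_apply' p]; exact (hfar x hx (j + 1) (by omega)).1)
        (by linarith) (by linarith [hp (p^[j] x), (Nat.cast_nonneg N : (0 : ℝ) ≤ N)]) (by linarith)
      rw [← h1, ih (by omega), ← hstep _ (hfar x hx j (by omega)).2]
      abel
  intro x hx y hy hxy
  obtain ⟨m, hm, l, hl, hml⟩ := hN x y hxy
  have hxK : x ∉ K := (hfar x hx 0 (by omega)).1
  have hyK : y ∉ K := (hfar y hy 0 (by omega)).1
  have hzK : p^[m] x ∉ K := (hfar x hx m (by omega)).1
  have e1 := horbit x hx m hm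
  have e2 := horbit y hy l hl
  rw [← hml] at e2
  have d1 := dist_iterate_le hp m x
  have d2 := dist_iterate_le hp l y
  rw [← hml] at d2
  have hm' : (m : ℝ) ≤ N := by exact_mod_cast hm
  have hl' : (l : ℝ) ≤ N := by exact_mod_cast hl
  have h3 := hcK x hxK y hyK _ hzK (hxy.trans (le_max_left _ _))
    (le_trans (by linarith) (le_max_right _ _)) (le_trans (by linarith) (le_max_right _ _))
  rw [e1, e2] at h3
  rw [eq_sub_of_add_eq h3]
  abel

theorem isCoarselyAcyclic_of_isEmpty [IsEmpty T] : IsCoarselyAcyclic T A :=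
  fun _ _ => ⟨fun _ => 0, fun _ => ⟨∅, Bornology.isBounded_empty, fun x => isEmptyElim x⟩⟩

theorem IsVertexTree.isCoarselyAcyclic (hT : IsVertexTree T) : IsCoarselyAcyclic T A := by
  obtain ⟨G, hG, hd⟩ := hT
  have hc : G.Connected := hG.connected
  obtain ⟨o⟩ := hc.nonempty
  choose q hq using fun x => (hc x o).exists_walk_length_eq_dist
  let p : T → T := fun x => (q x).snd
  have hparent : ∀ x y, G.Adj x y → G.dist o x = G.dist o y + 1 → p x = y := by
    intro x y hadj hxy
    rw [G.dist_comm, G.dist_comm (u := o)] at hxy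
    -- Prolonging the chosen geodesic of y by the edge gives a shortest walk from x; paths in a tree
    -- are unique, so it is `q x`.
    have hlen : ((q y).cons hadj).length = G.dist x o := by
      rw [SimpleGraph.Walk.length_cons, hq, hxy]
    have h := (hG.isAcyclic.subsingleton_path x o).elim
      ⟨q x, (q x).isPath_of_length_eq_dist (hq x)⟩
      ⟨_, ((q y).cons hadj).isPath_of_length_eq_dist hlen⟩
    have h' : q x = (q y).cons hadj := congrArg Subtype.val h
    simp only [p, h', SimpleGraph.Walk.snd_cons]
  -- The second vertex of the empty walk is, by convention, its only vertex.
  have hpo : p o = o := by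
    have h : (q o).length = 0 := by rw [hq, SimpleGraph.dist_self]
    simp only [p, SimpleGraph.Walk.eq_nil_iff_nil.2 (SimpleGraph.Walk.length_eq_zero_iff.1 h)]
    rfl
  have hp : ∀ x, x ≠ o → G.Adj x (p x) ∧ G.dist o x = G.dist o (p x) + 1 := by
    intro x hx
    have hnil : ¬ (q x).Nil := SimpleGraph.Walk.not_nil_of_ne hx
    have hadj : G.Adj x (p x) := (q x).adj_snd hnil
    refine ⟨hadj, ?_⟩
    have h1 := (q x).length_tail_add_one hnil
    have h2 := SimpleGraph.dist_le (q x).tail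
    have h3 := hq x
    have h4 := hG.dist_eq_dist_add_one_of_adj o hadj
    rw [G.dist_comm, G.dist_comm (v := p x)] at h4 ⊢
    simp only [p] at h4 ⊢
    omega
  have huniq : ∀ x y, G.Adj x y → p x = y ∨ p y = x := fun x y hadj =>
    (hG.dist_eq_dist_add_one_of_adj o hadj).imp (hparent x y hadj) (hparent y x hadj.symm)
  have hwalk : ∀ {x y : T} (w : G.Walk x y), ∃ m ≤ w.length, ∃ l ≤ w.length,
      p^[m] x = p^[l] y := by
    intro x y w
    induction w with
    | nil => exact ⟨0, le_rfl, 0, le_rfl, rfl⟩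
    | @cons x x' y hadj w ih =>
      obtain ⟨m, hm, l, hl, hml⟩ := ih
      simp only [SimpleGraph.Walk.length_cons]
      rcases huniq x x' hadj with h | h
      · exact ⟨m + 1, by omega, l, by omega, by rw [Function.iterate_succ_apply, h, hml]⟩
      · cases m with
        | zero =>
          refine ⟨0, by omega, l + 1, by omega, ?_⟩
          rw [Function.iterate_succ_apply', ← hml]
          simp [h]
        | succ m =>
          refine ⟨m, by omega, l, by omega, ?_⟩
          rw [← hml, Function.iterate_succ_apply, h]
  refine isCoarselyAcyclic_of_parent o p (G.dist o) (fun x => ?_) (fun x hx => ?_) (fun R => ?_)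
  · by_cases hx : x = o
    · rw [hx, hpo, dist_self]; exact zero_le_one
    · rw [hd, SimpleGraph.dist_eq_one_iff_adj.2 (hp x hx).1, Nat.cast_one]
  · refine (hp x ?_).2
    rintro rfl
    rw [dist_self] at hx
    linarith
  · refine ⟨⌊R⌋₊, fun x y hxy => ?_⟩
    obtain ⟨w, hw⟩ := (hc x y).exists_walk_length_eq_dist
    obtain ⟨m, hm, l, hl, hml⟩ := hwalk w
    have : G.dist x y ≤ ⌊R⌋₊ := Nat.le_floor (by rw [← hd]; exact hxy)
    exact ⟨m, by omega, l, by omega, hml⟩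

end Tree

/-! ### Geodesics and branch points in real trees -/

section RealTree

variable {T : Type u} [MetricSpace T] {A : Type u} [AddCommGroup A]

/-- `γ` restricts to an isometric embedding of `[0, D]`. -/
def IsGeodesicOn (γ : ℝ → T) (D : ℝ) : Prop :=
  ∀ s ∈ Set.Icc 0 D, ∀ t ∈ Set.Icc 0 D, dist (γ s) (γ t) = |s - t|

theorem IsGeodesicOn.dist_zero {γ : ℝ → T} {D : ℝ} (h : IsGeodesicOn γ D) {s : ℝ}
    (hs : s ∈ Set.Icc 0 D) : dist (γ 0) (γ s) = s := by
  rw [h 0 ⟨le_rfl, hs.1.trans hs.2⟩ s hs, zero_sub, abs_neg, abs_of_nonneg hs.1]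

/-- The restriction of a geodesic to `[a, b]` is a geodesic segment. -/
theorem IsGeodesicOn.isGeodesicSegment {γ : ℝ → T} {D : ℝ} (h : IsGeodesicOn γ D) {a b : ℝ}
    (ha : 0 ≤ a) (hab : a ≤ b) (hb : b ≤ D) :
    IsGeodesicSegment (γ '' Set.Icc a b) (γ a) (γ b) := by
  have hd : dist (γ a) (γ b) = b - a := by
    rw [h a ⟨ha, hab.trans hb⟩ b ⟨ha.trans hab, hb⟩, abs_sub_comm, abs_of_nonneg (by linarith)]
  refine ⟨fun s => γ (a + s), by simp, by simp [hd], ?_, ?_⟩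
  · rw [hd]
    rintro s ⟨hs0, hs1⟩ t ⟨ht0, ht1⟩
    rw [h _ ⟨by linarith, by linarith⟩ _ ⟨by linarith, by linarith⟩]
    congr 1
    ring
  · rw [hd]
    ext z
    constructor
    · rintro ⟨s, ⟨hs0, hs1⟩, rfl⟩
      exact ⟨s - a, ⟨by linarith, by linarith⟩, by simp⟩
    · rintro ⟨s, ⟨hs0, hs1⟩, rfl⟩
      exact ⟨a + s, ⟨by linarith, by linarith⟩, rfl⟩

theorem IsGeodesicSegment.symm {S : Set T} {x y : T} (h : IsGeodesicSegment S x y) :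
    IsGeodesicSegment S y x := by
  obtain ⟨γ, h0, h1, hγ, rfl⟩ := h
  rw [IsGeodesicSegment, dist_comm y x]
  refine ⟨fun s => γ (dist x y - s), by simp [h1], by simp [h0], ?_, ?_⟩
  · rintro s ⟨hs0, hs1⟩ t ⟨ht0, ht1⟩
    rw [hγ _ ⟨by linarith, by linarith⟩ _ ⟨by linarith, by linarith⟩, abs_sub_comm s t]
    congr 1
    ring
  · ext z
    constructor
    · rintro ⟨s, ⟨hs0, hs1⟩, rfl⟩
      exact ⟨dist x y - s, ⟨by linarith, by linarith⟩, by simp⟩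
    · rintro ⟨s, ⟨hs0, hs1⟩, rfl⟩
      exact ⟨dist x y - s, ⟨by linarith, by linarith⟩, rfl⟩

theorem IsGeodesicSegment.dist_add_dist {S : Set T} {x y z : T} (h : IsGeodesicSegment S x y)
    (hz : z ∈ S) : dist x z + dist z y = dist x y := by
  obtain ⟨γ, h0, h1, hγ, rfl⟩ := h
  obtain ⟨s, hs, rfl⟩ := hz
  have e1 := hγ 0 ⟨le_rfl, dist_nonneg⟩ s hs
  have e2 := hγ s hs _ ⟨dist_nonneg, le_rfl⟩
  rw [h0, zero_sub, abs_neg, abs_of_nonneg hs.1] at e1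
  rw [h1, abs_sub_comm, abs_of_nonneg (by linarith [hs.2])] at e2
  linarith

/-- Geodesics of a real tree that start at the same point agree up to every common value. -/
theorem IsRealTree.geodesic_eq (hT : IsRealTree T) {γ δ : ℝ → T} {D D' t : ℝ}
    (hγ : IsGeodesicOn γ D) (hδ : IsGeodesicOn δ D') (h0 : γ 0 = δ 0) (ht : γ t = δ t)
    (htD : t ≤ D) (htD' : t ≤ D') {s : ℝ} (hs0 : 0 ≤ s) (hst : s ≤ t) : γ s = δ s := by
  have h1 := hγ.isGeodesicSegment le_rfl (hs0.trans hst) htD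
  have h2 := hδ.isGeodesicSegment le_rfl (hs0.trans hst) htD'
  rw [← h0, ← ht] at h2
  have hmem : γ s ∈ δ '' Set.Icc 0 t :=
    (hT.existsUnique_segment _ _).unique h1 h2 ▸ ⟨s, ⟨hs0, hst⟩, rfl⟩
  obtain ⟨r, ⟨hr0, hrt⟩, hr⟩ := hmem
  -- The parameter of a point on either geodesic is its distance from the common origin, so r = s.
  have e1 := hγ.dist_zero ⟨hs0, hst.trans htD⟩
  have e2 := hδ.dist_zero ⟨hr0, hrt.trans htD'⟩
  rw [hr, ← h0] at e2
  rw [← hr, ← e1, e2]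

/-- Two geodesics of a real tree that start at the same point branch at a point on the
segment between their endpoints. -/
theorem IsRealTree.exists_branch (hT : IsRealTree T) {γ δ : ℝ → T} {D D' : ℝ}
    (hγ : IsGeodesicOn γ D) (hδ : IsGeodesicOn δ D') (h0 : γ 0 = δ 0) (hD : 0 ≤ D) (hD' : 0 ≤ D') :
    ∃ t, 0 ≤ t ∧ t ≤ D ∧ t ≤ D' ∧ γ t = δ t ∧ (D - t) + (D' - t) = dist (γ D) (δ D') := by
  let S : Set ℝ := {t | t ∈ Set.Icc 0 (min D D') ∧ γ t = δ t}
  have hS0 : (0 : ℝ) ∈ S := ⟨⟨le_rfl, le_min hD hD'⟩, h0⟩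
  have hSb : BddAbove S := ⟨min D D', fun t ht => ht.1.2⟩
  have ht0 : 0 ≤ sSup S := le_csSup hSb hS0
  have htm : sSup S ≤ min D D' := csSup_le ⟨0, hS0⟩ fun t ht => ht.1.2
  have htD : sSup S ≤ D := htm.trans (min_le_left _ _)
  have htD' : sSup S ≤ D' := htm.trans (min_le_right _ _)
  have hle : ∀ t ∈ S, t ≤ sSup S := fun t ht => le_csSup hSb ht
  -- The geodesics still agree at the supremum by continuity, and part there for good: a later
  -- common point would have equal parameters and lie in S.
  have heq : γ (sSup S) = δ (sSup S) := by
    refine eq_of_forall_dist_le fun ε hε => ?_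
    obtain ⟨t, ht, hlt⟩ := exists_lt_of_lt_csSup ⟨0, hS0⟩ (sub_lt_self (sSup S) (half_pos hε))
    have e1 := hγ (sSup S) ⟨ht0, htD⟩ t ⟨ht.1.1, (hle t ht).trans htD⟩
    have e2 := hδ t ⟨ht.1.1, (hle t ht).trans htD'⟩ (sSup S) ⟨ht0, htD'⟩
    rw [abs_of_nonneg (by linarith [hle t ht])] at e1
    rw [abs_sub_comm, abs_of_nonneg (by linarith [hle t ht]), ← ht.2] at e2
    linarith [dist_triangle (γ (sSup S)) (γ t) (δ (sSup S))]
  refine ⟨sSup S, ht0, htD, htD', heq, ?_⟩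
  have s1 := (hγ.isGeodesicSegment ht0 htD le_rfl).symm
  have s2 := hδ.isGeodesicSegment ht0 htD' le_rfl
  rw [← heq] at s2
  have hint : γ '' Set.Icc (sSup S) D ∩ δ '' Set.Icc (sSup S) D' = {γ (sSup S)} := by
    refine Set.Subset.antisymm ?_ ?_
    · rintro z ⟨⟨s, ⟨hs, hsD⟩, rfl⟩, r, ⟨hr, hrD⟩, hrs⟩
      have e1 := hγ.dist_zero ⟨ht0.trans hs, hsD⟩
      have e2 := hδ.dist_zero ⟨ht0.trans hr, hrD⟩
      rw [hrs, ← h0, e1] at e2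
      subst e2
      have := hle s ⟨⟨ht0.trans hs, le_min hsD hrD⟩, hrs.symm⟩
      rw [Set.mem_singleton_iff, le_antisymm this hs]
    · rintro _ rfl
      exact ⟨⟨_, ⟨le_rfl, htD⟩, rfl⟩, _, ⟨le_rfl, htD'⟩, heq.symm⟩
  have h := (hT.concat _ _ _ _ _ s1 s2 hint).dist_add_dist (z := γ (sSup S))
    (Or.inl ⟨_, ⟨le_rfl, htD⟩, rfl⟩)
  have e1 := hγ D ⟨hD, le_rfl⟩ (sSup S) ⟨ht0, htD⟩
  have e2 := hδ (sSup S) ⟨ht0, htD'⟩ D' ⟨hD', le_rfl⟩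
  rw [abs_of_nonneg (by linarith)] at e1
  rw [abs_sub_comm, abs_of_nonneg (by linarith), ← heq] at e2
  rw [← h, e1, e2]

theorem IsRealTree.isCoarselyAcyclic (hT : IsRealTree T) : IsCoarselyAcyclic T A := by
  rcases isEmpty_or_nonempty T with _ | ⟨⟨o⟩⟩
  · exact isCoarselyAcyclic_of_isEmpty
  have hgeo : ∀ x, ∃ γ : ℝ → T, γ 0 = o ∧ γ (dist o x) = x ∧ IsGeodesicOn γ (dist o x) := by
    intro x
    obtain ⟨_, ⟨γ, h0, h1, hγ, -⟩, -⟩ := hT.existsUnique_segment o x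
    exact ⟨γ, h0, h1, hγ⟩
  choose γ h0 h1 hγ using hgeo
  let n : T → ℕ := fun x => ⌈dist o x⌉₊
  -- The first step descends to the next lower integer height, and later ones by 1, so that merged
  -- orbits coincide exactly.
  let p : T → T := fun x => γ x ((n x - 1 : ℕ) : ℝ)
  have hlevel : ∀ x m, ((n x - (m + 1) : ℕ) : ℝ) ≤ dist o x := by
    intro x m
    rcases Nat.eq_zero_or_pos (n x - (m + 1)) with h | h
    · rw [h, Nat.cast_zero]; exact dist_nonneg
    · exact (Nat.lt_ceil.1 (show n x - (m + 1) < n x by omega)).le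
  have hdist : ∀ x m, dist o (γ x ((n x - (m + 1) : ℕ) : ℝ)) = ((n x - (m + 1) : ℕ) : ℝ) := by
    intro x m
    have h := (hγ x).dist_zero ⟨Nat.cast_nonneg _, hlevel x m⟩
    rwa [h0] at h
  have hagree : ∀ x y t, 0 ≤ t → t ≤ dist o x → t ≤ dist o y → γ x t = γ y t →
      ∀ s, 0 ≤ s → s ≤ t → γ x s = γ y s := fun x y t _ hx hy ht s hs hst =>
    hT.geodesic_eq (hγ x) (hγ y) ((h0 x).trans (h0 y).symm) ht hx hy hs hst
  have hiter : ∀ m x, p^[m + 1] x = γ x ((n x - (m + 1) : ℕ) : ℝ) := by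
    intro m x
    induction m with
    | zero => rfl
    | succ m ih =>
      rw [Function.iterate_succ_apply', ih]
      have hd := hdist x m
      set w := γ x ((n x - (m + 1) : ℕ) : ℝ) with hw
      have hn : n w = n x - (m + 1) := by simp only [n] at hd ⊢; rw [hd, Nat.ceil_natCast]
      have hw' : γ w ((n x - (m + 1) : ℕ) : ℝ) = γ x ((n x - (m + 1) : ℕ) : ℝ) := by
        rw [← hw, ← hd, h1]
      simp only [p]
      rw [hn, Nat.sub_sub]
      exact hagree w x _ (Nat.cast_nonneg _) hd.ge (hlevel x m) hw' _ (Nat.cast_nonneg _)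
        (by exact_mod_cast (show n x - (m + 1 + 1) ≤ n x - (m + 1) by omega))
  refine isCoarselyAcyclic_of_parent o p n (fun x => ?_) (fun x hx => ?_) (fun R => ?_)
  · have h := hγ x _ ⟨dist_nonneg, le_rfl⟩ _ ⟨Nat.cast_nonneg _, hlevel x 0⟩
    rw [h1, abs_of_nonneg (sub_nonneg.2 (hlevel x 0))] at h
    have h2 : dist o x ≤ n x := Nat.le_ceil _
    have h3 : (n x : ℝ) ≤ ((n x - (0 + 1) : ℕ) : ℝ) + 1 := by
      exact_mod_cast (show n x ≤ n x - (0 + 1) + 1 by omega)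
    exact h.le.trans (by linarith)
  · have hpos : 0 < n x := Nat.ceil_pos.2 (by rw [dist_comm]; linarith)
    have h : n (p x) = n x - 1 := by
      have hd := hdist x 0
      change ⌈dist o (γ x ((n x - (0 + 1) : ℕ) : ℝ))⌉₊ = _
      rw [hd, Nat.ceil_natCast]
    omega
  · refine ⟨⌈R⌉₊ + 1, fun x y hxy => ?_⟩
    obtain ⟨t, ht0, htx, hty, ht, hsum⟩ := hT.exists_branch (hγ x) (hγ y)
      ((h0 x).trans (h0 y).symm) dist_nonneg dist_nonneg
    rw [h1, h1] at hsum
    -- Both orbits visit the integer height just below the branch point.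
    have hfl : (⌊t⌋₊ : ℝ) ≤ t := Nat.floor_le ht0
    have horbit : ∀ z, t ≤ dist o z → dist o z - t ≤ R →
        ∃ m ≤ ⌈R⌉₊ + 1, p^[m] z = γ z (⌊t⌋₊ : ℝ) := by
      intro z htz hz
      have hub : n z ≤ ⌊t⌋₊ + 1 + ⌈R⌉₊ := by
        refine Nat.ceil_le.2 ?_
        push_cast
        linarith [Nat.lt_floor_add_one t, Nat.le_ceil R]
      rcases lt_or_ge ⌊t⌋₊ (n z) with h | h
      · refine ⟨n z - ⌊t⌋₊ - 1 + 1, by omega, ?_⟩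
        rw [hiter, show n z - (n z - ⌊t⌋₊ - 1 + 1) = ⌊t⌋₊ by omega]
      · have h2 : dist o z ≤ ⌊t⌋₊ := (Nat.le_ceil _).trans (by exact_mod_cast h)
        refine ⟨0, by omega, ?_⟩
        rw [show (⌊t⌋₊ : ℝ) = dist o z by linarith, h1]
        rfl
    obtain ⟨m, hm, hmx⟩ := horbit x htx (by linarith)
    obtain ⟨l, hl, hly⟩ := horbit y hty (by linarith)
    exact ⟨m, hm, l, hl, by
      rw [hmx, hly, hagree x y t ht0 htx hty ht _ (Nat.cast_nonneg _) hfl]⟩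

theorem IsMetricTree.isCoarselyAcyclic (hT : IsMetricTree T) : IsCoarselyAcyclic T A :=
  hT.elim IsRealTree.isCoarselyAcyclic IsVertexTree.isCoarselyAcyclic

end RealTree

/-! ### Coarse covers, gluing, and sections of the constant sheaf as functions -/

section Restriction

variable {X : Type u} {F : (Set X)ᵒᵖ ⥤ AddCommGrpCat.{u}}

variable (F) in
/-- Restriction of sections of a presheaf on subsets. -/
def res {U V : Set X} (h : V ⊆ U) : F.obj (op U) →+ F.obj (op V) :=
  (F.map (homOfLE h : V ⟶ U).op).hom

theorem res_res {U V W : Set X} (h : V ⊆ U) (h' : W ⊆ V) (x : F.obj (op U)) :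
    res F h' (res F h x) = res F (h'.trans h) x := by
  simp only [res]
  rw [← ConcreteCategory.comp_apply, ← Functor.map_comp]
  rfl

theorem app_res {G : (Set X)ᵒᵖ ⥤ AddCommGrpCat.{u}} (φ : F ⟶ G) {U V : Set X} (h : V ⊆ U)
    (x : F.obj (op U)) : φ.app (op V) (res F h x) = res G h (φ.app (op U) x) :=
  NatTrans.naturality_apply φ (homOfLE h : V ⟶ U).op x

theorem app_const {A : Type u} [AddCommGroup A] (φ : constPresheaf X A ⟶ F) {U V : Set X}
    (h : V ⊆ U) (a : A) : φ.app (op V) a = res F h (φ.app (op U) a) :=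
  NatTrans.naturality_apply φ (homOfLE h : V ⟶ U).op a

end Restriction

section Gluing

variable {X : Type u} [MetricSpace X]

/-- A family of sets covers `U` at every scale: every point of `U` outside a bounded set has its
`R`-ball in `U` contained in a member of the family. -/
def CoversCoarsely {ι : Type*} (U : Set X) (V : ι → Set X) : Prop :=
  ∀ R : ℝ, ∃ K : Set X, Bornology.IsBounded K ∧
    ∀ x ∈ U, x ∉ K → ∃ i, ∀ y ∈ U, dist x y ≤ R → y ∈ V i

theorem IsCoarseCover.coversCoarsely {n : ℕ} {U : Set X} {V : Fin n → Set X}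
    (h : IsCoarseCover U V) : CoversCoarsely U V := by
  intro R
  refine ⟨_, h.2 ((U ×ˢ U) ∩ {p | dist p.1 p.2 ≤ R}) Set.inter_subset_left
    ⟨R, fun p hp => hp.2⟩, fun x hx hxK => ?_⟩
  by_contra! hc
  refine hxK ⟨hx, Set.mem_iInter.2 fun i => ?_⟩
  obtain ⟨y, hy, hxy, hyV⟩ := hc i
  exact ⟨y, ⟨hy, hyV⟩, ⟨hx, hy⟩, hxy⟩

theorem CoversCoarsely.isCoarseCover {n : ℕ} {U : Set X} {V : Fin n → Set X}
    (hV : ∀ i, V i ⊆ U) (h : CoversCoarsely U V) : IsCoarseCover U V := by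
  refine ⟨hV, ?_⟩
  rintro E hE ⟨R, hR⟩
  obtain ⟨K, hK, hKV⟩ := h R
  refine hK.subset ?_
  rintro x ⟨hx, hxi⟩
  by_contra hxK
  obtain ⟨i, hi⟩ := hKV x hx hxK
  obtain ⟨y, hy, hxy⟩ := Set.mem_iInter.1 hxi i
  exact hy.2 (hi y hy.1 (hR _ hxy))

theorem exists_coversCoarsely_of_mem {U : Set X} {S : Sieve U} (hS : S ∈ coarseTopology X U) :
    ∃ (n : ℕ) (V : Fin n → Set X) (hV : ∀ i, V i ⊆ U), CoversCoarsely U V ∧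
      ∀ i, S (homOfLE (hV i)) := by
  obtain ⟨n, V, hV, hVS⟩ := hS
  exact ⟨n, V, hV.1, hV.coversCoarsely, fun i => (hVS i).choose_spec⟩

/-- Every point outside a suitable bounded set has its `R`-ball disjoint from a given bounded
set. -/
theorem exists_isBounded_ball_disjoint {K : Set X} (hK : Bornology.IsBounded K) (R : ℝ) :
    ∃ K' : Set X, Bornology.IsBounded K' ∧ K ⊆ K' ∧
      ∀ x ∉ K', ∀ y, dist x y ≤ R → y ∉ K := by
  refine ⟨K ∪ Metric.cthickening R K, hK.union hK.cthickening, Set.subset_union_left, ?_⟩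
  intro x hx y hxy hy
  exact hx (Or.inr (Metric.mem_cthickening_of_dist_le x y R K hy hxy))

variable {F : (Set X)ᵒᵖ ⥤ AddCommGrpCat.{u}}

theorem existsUnique_glue (hF : Presheaf.IsSheaf (coarseTopology X) F) {ι : Type*} [Finite ι]
    {U : Set X} {V : ι → Set X} (hV : ∀ i, V i ⊆ U) (hc : CoversCoarsely U V)
    (x : ∀ i, F.obj (op (V i)))
    (hx : ∀ i j Z (hi : Z ⊆ V i) (hj : Z ⊆ V j), res F hi (x i) = res F hj (x j)) :
    ∃! t : F.obj (op U), ∀ i, res F (hV i) t = x i := by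
  obtain ⟨n, ⟨e⟩⟩ := Finite.exists_equiv_fin ι
  have hsh : Presieve.IsSheaf (coarseTopology X) (F ⋙ forget AddCommGrpCat.{u}) :=
    (isSheaf_iff_isSheaf_of_type _ _).1 ((Presheaf.isSheaf_iff_isSheaf_forget _ _ _).1 hF)
  have hcov : Sieve.generate (Presieve.ofArrows V fun i => (homOfLE (hV i) : V i ⟶ U)) ∈
      coarseTopology X U := by
    refine ⟨n, fun k => V (e.symm k), CoversCoarsely.isCoarseCover (fun k => hV _) ?_, fun k =>
      ⟨homOfLE (hV _), Sieve.le_generate _ _ _ (Presieve.ofArrows.mk (e.symm k))⟩⟩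
    intro R
    obtain ⟨K, hK, h⟩ := hc R
    refine ⟨K, hK, fun y hy hyK => ?_⟩
    obtain ⟨i, hi⟩ := h y hy hyK
    exact ⟨e i, by simpa using hi⟩
  have h := (Presieve.isSheafFor_iff_generate _).2 (hsh _ hcov)
  exact (Presieve.isSheafFor_arrows_iff _ _).1 h x
    fun i j Z gi gj _ => hx i j Z (leOfHom gi) (leOfHom gj)

theorem section_ext (hF : Presheaf.IsSheaf (coarseTopology X) F) {ι : Type*} [Finite ι]
    {U : Set X} {V : ι → Set X} (hV : ∀ i, V i ⊆ U) (hc : CoversCoarsely U V)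
    {s t : F.obj (op U)} (h : ∀ i, res F (hV i) s = res F (hV i) t) : s = t :=
  (existsUnique_glue hF hV hc (fun i => res F (hV i) t)
    (fun i j Z hi hj => by rw [res_res, res_res])).unique h fun _ => rfl

/-- The function `f` does not vary at bounded scales on `U` outside bounded sets. -/
def IsCoarselyLocallyConstant {A : Type*} (U : Set X) (f : X → A) : Prop :=
  ∀ R : ℝ, ∃ K : Set X, Bornology.IsBounded K ∧
    ∀ x ∈ U, x ∉ K → ∀ y ∈ U, y ∉ K → dist x y ≤ R → f x = f y

section Const

variable {A : Type u} [AddCommGroup A] (φ : constPresheaf X A ⟶ F)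

/-- On each member of some coarse cover the two constants would agree, so that cover has no members;
the empty family covers only bounded sets. -/
theorem isBounded_of_const_eq [Presheaf.IsLocallyInjective (coarseTopology X) φ] {W : Set X}
    {a b : A} (hab : a ≠ b) (h : φ.app (op W) a = φ.app (op W) b) : Bornology.IsBounded W := by
  obtain ⟨n, V, hV, hc, hS⟩ := exists_coversCoarsely_of_mem
    (Presheaf.equalizerSieve_mem (coarseTopology X) φ (X := op W) a b h)
  obtain ⟨K, hK, hKV⟩ := hc 0
  refine hK.subset fun x hx => ?_
  by_contra hxK
  obtain ⟨i, -⟩ := hKV x hx hxK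
  exact hab (hS i)

/-- A section that is locally constant is described by a coarsely locally constant function. -/
theorem exists_function_of_imageSieve_mem (hF : Presheaf.IsSheaf (coarseTopology X) F)
    [Presheaf.IsLocallyInjective (coarseTopology X) φ] {U : Set X} (t : F.obj (op U))
    (ht : Presheaf.imageSieve φ t ∈ coarseTopology X U) :
    ∃ f : X → A, IsCoarselyLocallyConstant U f ∧
      ∀ (a : A) (W : Set X) (hW : W ⊆ U), (∀ x ∈ W, f x = a) →
        res F hW t = φ.app (op W) a := by
  classical
  obtain ⟨n, V, hV, hc, hS⟩ := exists_coversCoarsely_of_mem ht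
  choose a ha using hS
  have ha' : ∀ k, φ.app (op (V k)) (a k) = res F (hV k) t := ha
  -- The points where overlapping members carry different labels.
  let B : Set X := ⋃ k, ⋃ l, {x | a k ≠ a l ∧ x ∈ V k ∩ V l}
  have hB : Bornology.IsBounded B := by
    refine Bornology.isBounded_iUnion.2 fun k => Bornology.isBounded_iUnion.2 fun l => ?_
    by_cases hkl : a k = a l
    · simp [hkl]
    refine (isBounded_of_const_eq φ hkl ?_).subset fun x hx => hx.2
    rw [app_const φ Set.inter_subset_left (a k), app_const φ Set.inter_subset_right (a l), ha', ha',
      res_res, res_res]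
  let f : X → A := fun x => if h : ∃ k, x ∈ V k then a h.choose else 0
  have hf : ∀ x ∉ B, ∀ k, x ∈ V k → f x = a k := by
    intro x hx k hk
    have hex : ∃ k, x ∈ V k := ⟨k, hk⟩
    by_contra hne
    refine hx (Set.mem_iUnion.2 ⟨hex.choose, Set.mem_iUnion.2 ⟨k, ?_, hex.choose_spec, hk⟩⟩)
    simpa only [f, dif_pos hex] using hne
  refine ⟨f, fun R => ?_, fun b W hW hb => ?_⟩
  · obtain ⟨K, hK, hKV⟩ := hc (max R 0)
    refine ⟨K ∪ B, hK.union hB, fun x hx hxK y hy hyK hxy => ?_⟩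
    obtain ⟨k, hk⟩ := hKV x hx fun h => hxK (Or.inl h)
    rw [hf x (fun h => hxK (Or.inr h)) k (hk x hx (by simp)),
      hf y (fun h => hyK (Or.inr h)) k (hk y hy (hxy.trans (le_max_left _ _)))]
  -- The members labelled b suffice: a far point of W lies with its ball in some `V k`, and its
  -- value b is the label of that member.
  · refine section_ext hF (ι := {k // a k = b}) (V := fun k => W ∩ V k)
      (fun k => Set.inter_subset_left) (fun R => ?_) fun k => ?_
    · obtain ⟨K, hK, hKV⟩ := hc (max R 0)
      refine ⟨K ∪ B, hK.union hB, fun x hx hxK => ?_⟩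
      obtain ⟨k, hk⟩ := hKV x (hW hx) fun h => hxK (Or.inl h)
      refine ⟨⟨k, ?_⟩, fun y hy hxy => ⟨hy, hk y (hW hy) (hxy.trans (le_max_left _ _))⟩⟩
      rw [← hb x hx, hf x (fun h => hxK (Or.inr h)) k (hk x (hW hx) (by simp))]
    · obtain ⟨k, rfl⟩ := k
      rw [← app_const φ Set.inter_subset_left (a k), app_const φ Set.inter_subset_right (a k), ha',
        res_res, res_res]

end Const

end Gluing

/-! ### Čech cocycles as functions of pairs of points -/

section Cocycle

variable {X : Type u} [MetricSpace X] {A : Type u} [AddCommGroup A]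

/-- On a coarsely acyclic space, a Čech `1`-cocycle of coarsely locally constant functions for a
coarse cover is, outside a bounded set, the coboundary of coarsely locally constant functions. -/
theorem IsCoarselyAcyclic.exists_coboundary (hX : IsCoarselyAcyclic X A) {ι : Type*} [Finite ι]
    {V : ι → Set X} (hV : CoversCoarsely Set.univ V) (f : ι → ι → X → A)
    (hf : ∀ i j, IsCoarselyLocallyConstant (V i ∩ V j) (f i j))
    {B : Set X} (hB : Bornology.IsBounded B)
    (hcocycle : ∀ i j k, ∀ x ∈ V i, x ∈ V j → x ∈ V k → x ∉ B → f i j x + f j k x = f i k x) :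
    ∃ e : ι → X → A, (∀ i, IsCoarselyLocallyConstant (V i) (e i)) ∧
      ∀ i j, ∀ x ∈ V i, x ∈ V j → x ∉ B → f i j x = e j x - e i x := by
  classical
  -- Pointwise contraction of the Čech complex: an arbitrary choice of member at each x splits f,
  -- with no regularity in x.
  let g : ι → X → A := fun j x => if h : ∃ i, x ∈ V i then f h.choose j x else 0
  have hg : ∀ i j, ∀ x ∈ V i, x ∈ V j → x ∉ B → f i j x = g j x - g i x := by
    intro i j x hi hj hx
    have hex : ∃ i, x ∈ V i := ⟨i, hi⟩
    simp only [g, dif_pos hex]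
    rw [← hcocycle _ i j x hex.choose_spec hi hj hx]
    abel
  -- Far out the choice of i is immaterial, because g j - g i = f i j does not vary between x and y.
  let c : X → X → A := fun x y =>
    if h : ∃ i, x ∈ V i ∧ y ∈ V i then g h.choose x - g h.choose y else 0
  have hc : ∀ R : ℝ, ∃ K : Set X, Bornology.IsBounded K ∧ ∀ i, ∀ x ∈ V i, ∀ y ∈ V i,
      x ∉ K → y ∉ K → dist x y ≤ R → c x y = g i x - g i y := by
    intro R
    choose K hK hKf using fun i j => hf i j R
    refine ⟨B ∪ ⋃ i, ⋃ j, K i j, hB.union (Bornology.isBounded_iUnion.2 fun i =>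
      Bornology.isBounded_iUnion.2 fun j => hK i j), fun i x hxi y hyi hx hy hxy => ?_⟩
    have hex : ∃ i, x ∈ V i ∧ y ∈ V i := ⟨i, hxi, hyi⟩
    have hmem : ∀ {z : X} i j, z ∉ B ∪ ⋃ i, ⋃ j, K i j → z ∉ K i j := fun i j hz h =>
      hz (Or.inr (Set.mem_iUnion.2 ⟨i, Set.mem_iUnion.2 ⟨j, h⟩⟩))
    have hj := hex.choose_spec
    have h1 := hKf i hex.choose x ⟨hxi, hj.1⟩ (hmem _ _ hx) y ⟨hyi, hj.2⟩ (hmem _ _ hy) hxy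
    rw [hg i _ x hxi hj.1 (fun h => hx (Or.inl h)),
      hg i _ y hyi hj.2 (fun h => hy (Or.inl h))] at h1
    simp only [c, dif_pos hex]
    rw [sub_eq_sub_iff_add_eq_add] at h1 ⊢
    rw [add_comm (g i x), ← h1, add_comm]
  obtain ⟨h, hh⟩ := hX c (fun R => by
    obtain ⟨K, hK, hKc⟩ := hc R
    obtain ⟨K', hK', hKV⟩ := hV (max R 0)
    refine ⟨K ∪ K', hK.union hK', fun x hx y hy z hz hxy hyz hxz => ?_⟩
    obtain ⟨i, hi⟩ := hKV x trivial fun h => hx (Or.inr h)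
    have hxi := hi x trivial (by simp)
    have hyi := hi y trivial (hxy.trans (le_max_left _ _))
    have hzi := hi z trivial (hxz.trans (le_max_left _ _))
    have hx' : x ∉ K := fun h => hx (Or.inl h)
    have hy' : y ∉ K := fun h => hy (Or.inl h)
    have hz' : z ∉ K := fun h => hz (Or.inl h)
    rw [hKc i x hxi y hyi hx' hy' hxy, hKc i y hyi z hzi hy' hz' hyz,
      hKc i x hxi z hzi hx' hz' hxz]
    abel)
  refine ⟨fun i x => g i x - h x, fun i R => ?_, fun i j x hi hj hx => ?_⟩
  · obtain ⟨K, hK, hKc⟩ := hc R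
    obtain ⟨K', hK', hKh⟩ := hh R
    refine ⟨K ∪ K', hK.union hK', fun x hxi hx y hyi hy hxy => ?_⟩
    have h1 := hKc i x hxi y hyi (fun h => hx (Or.inl h)) (fun h => hy (Or.inl h)) hxy
    rw [hKh x (fun h => hx (Or.inr h)) y (fun h => hy (Or.inr h)) hxy] at h1
    rw [sub_eq_sub_iff_sub_eq_sub, h1]
  · rw [hg i j x hi hj hx, sub_sub_sub_cancel_right]

end Cocycle

/-! ### Lifting global sections -/

section Lift

variable {X : Type u} [MetricSpace X] {A : Type u} [AddCommGroup A] [Finite A]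
  {F G : (Set X)ᵒᵖ ⥤ AddCommGrpCat.{u}}

/-- On a coarsely acyclic space, a global section that lifts locally along a map of sheaves with
constant kernel lifts globally. -/
theorem IsCoarselyAcyclic.exists_lift (hX : IsCoarselyAcyclic X A)
    (hF : Presheaf.IsSheaf (coarseTopology X) F) (hG : Presheaf.IsSheaf (coarseTopology X) G)
    (φ : constPresheaf X A ⟶ F) [Presheaf.IsLocallyInjective (coarseTopology X) φ]
    (d : F ⟶ G) (hφd : φ ≫ d = 0)
    (hker : ∀ (U : Set X) (t : F.obj (op U)), d.app (op U) t = 0 →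
      Presheaf.imageSieve φ t ∈ coarseTopology X U)
    (s : G.obj (op Set.univ)) (hs : Presheaf.imageSieve d s ∈ coarseTopology X Set.univ) :
    ∃ t : F.obj (op Set.univ), d.app (op Set.univ) t = s := by
  obtain ⟨n, V, hVu, hV, hS⟩ := exists_coversCoarsely_of_mem hs
  choose t ht using hS
  have ht' : ∀ i, d.app (op (V i)) (t i) = res G (hVu i) s := ht
  have hφ0 : ∀ (U : Set X) (a : A), d.app (op U) (φ.app (op U) a) = 0 := by
    intro U a
    rw [← ConcreteCategory.comp_apply, ← NatTrans.comp_app, hφd]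
    rfl
  have hdiff : ∀ i j, d.app (op (V i ∩ V j))
      (res F Set.inter_subset_left (t i) - res F Set.inter_subset_right (t j)) = 0 := by
    intro i j
    rw [map_sub, app_res, app_res, ht', ht', res_res, res_res, sub_self]
  choose f hf hft using fun i j =>
    exists_function_of_imageSieve_mem φ hF _ (hker _ _ (hdiff i j))
  have hft' : ∀ i j (a : A) (W : Set X) (hi : W ⊆ V i) (hj : W ⊆ V j), (∀ x ∈ W, f i j x = a) →
      res F hi (t i) - res F hj (t j) = φ.app (op W) a := by
    intro i j a W hi hj hW
    have h := hft i j a W (Set.subset_inter hi hj) hW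
    rwa [map_sub, res_res, res_res] at h
  -- The cocycle identity fails on B. Finiteness of A makes this a finite union of pieces with
  -- constant values, each bounded by local injectivity.
  let B : Set X := ⋃ i, ⋃ j, ⋃ k, ⋃ p : A × A × A, {x | p.1 + p.2.1 ≠ p.2.2 ∧
    x ∈ V i ∧ x ∈ V j ∧ x ∈ V k ∧ f i j x = p.1 ∧ f j k x = p.2.1 ∧ f i k x = p.2.2}
  have hB : Bornology.IsBounded B := by
    refine Bornology.isBounded_iUnion.2 fun i => Bornology.isBounded_iUnion.2 fun j =>
      Bornology.isBounded_iUnion.2 fun k => Bornology.isBounded_iUnion.2 fun p => ?_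
    obtain ⟨a, b, c⟩ := p
    by_cases habc : a + b = c
    · simp [habc]
    refine isBounded_of_const_eq φ habc ?_
    have h1 := hft' i j a _ (fun x hx => hx.2.1) (fun x hx => hx.2.2.1)
      fun x (hx : x ∈ {x | a + b ≠ c ∧
        x ∈ V i ∧ x ∈ V j ∧ x ∈ V k ∧ f i j x = a ∧ f j k x = b ∧ f i k x = c}) => hx.2.2.2.2.1
    have h2 := hft' j k b _ (fun x hx => hx.2.2.1) (fun x hx => hx.2.2.2.1)
      fun x (hx : x ∈ {x | a + b ≠ c ∧
        x ∈ V i ∧ x ∈ V j ∧ x ∈ V k ∧ f i j x = a ∧ f j k x = b ∧ f i k x = c}) => hx.2.2.2.2.2.1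
    have h3 := hft' i k c _ (fun x hx => hx.2.1) (fun x hx => hx.2.2.2.1)
      fun x (hx : x ∈ {x | a + b ≠ c ∧
        x ∈ V i ∧ x ∈ V j ∧ x ∈ V k ∧ f i j x = a ∧ f j k x = b ∧ f i k x = c}) => hx.2.2.2.2.2.2
    exact (map_add (φ.app (op _)).hom a b).trans (by
      refine Eq.trans ?_ h3
      refine (congrArg₂ (· + ·) h1.symm h2.symm).trans ?_
      exact sub_add_sub_cancel _ _ _)
  obtain ⟨e, he, hfe⟩ := hX.exists_coboundary hV f hf hB (by
    intro i j k x hi hj hk hx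
    by_contra hne
    exact hx (Set.mem_iUnion.2 ⟨i, Set.mem_iUnion.2 ⟨j, Set.mem_iUnion.2 ⟨k, Set.mem_iUnion.2
      ⟨(_, _, _), hne, hi, hj, hk, rfl, rfl, rfl⟩⟩⟩⟩))
  let W : Fin n × A → Set X := fun q => {x | x ∈ V q.1 ∧ e q.1 x = q.2}
  have hWV : ∀ q, W q ⊆ V q.1 := fun q x hx => hx.1
  have hWc : CoversCoarsely Set.univ W := by
    intro R
    choose K hK hKe using fun i => he i (max R 0)
    obtain ⟨K₁, hK₁, hK₁V⟩ := hV (max R 0)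
    obtain ⟨K₂, hK₂, hsub, hdisj⟩ :=
      exists_isBounded_ball_disjoint (Bornology.isBounded_iUnion.2 hK) R
    refine ⟨K₁ ∪ K₂, hK₁.union hK₂, fun x _ hx => ?_⟩
    obtain ⟨i, hi⟩ := hK₁V x trivial fun h => hx (Or.inl h)
    refine ⟨(i, e i x), fun y _ hxy => ⟨hi y trivial (hxy.trans (le_max_left _ _)), ?_⟩⟩
    refine (hKe i x (hi x trivial (by simp)) ?_ y (hi y trivial (hxy.trans (le_max_left _ _))) ?_
      (hxy.trans (le_max_left _ _))).symm
    · exact fun h => hx (Or.inr (hsub (Set.mem_iUnion.2 ⟨i, h⟩)))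
    · exact fun h => hdisj x (fun h => hx (Or.inr h)) y hxy (Set.mem_iUnion.2 ⟨i, h⟩)
  obtain ⟨u, hu, -⟩ := existsUnique_glue hF (fun q => Set.subset_univ (W q)) hWc
    (fun q => res F (hWV q) (t q.1) + φ.app (op (W q)) q.2) (by
      intro q r Z hq hr
      rw [map_add, map_add, res_res, res_res, ← app_const, ← app_const]
      -- Removing a bounded set still leaves a coarse cover, so sections may be compared off B.
      refine section_ext hF (ι := Unit) (V := fun _ => Z \ B) (fun _ => Set.sdiff_subset) ?_
        fun _ => ?_
      · intro R
        obtain ⟨K, hK, -, hdisj⟩ := exists_isBounded_ball_disjoint hB R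
        exact ⟨K, hK, fun x _ hxK => ⟨(), fun y hy hxy => ⟨hy, hdisj x hxK y hxy⟩⟩⟩
      · rw [map_add, map_add, res_res, res_res, ← app_const, ← app_const]
        have h := hft' q.1 r.1 (r.2 - q.2) (Z \ B) (fun x hx => (hq hx.1).1)
          (fun x hx => (hr hx.1).1) (fun x hx => by
            rw [hfe _ _ x (hq hx.1).1 (hr hx.1).1 hx.2, (hq hx.1).2, (hr hx.1).2])
        have h' := h.trans (map_sub (φ.app (op (Z \ B))).hom r.2 q.2)
        rw [sub_eq_sub_iff_add_eq_add] at h'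
        exact h'.trans (add_comm _ _))
  refine ⟨u, section_ext hG (fun q => Set.subset_univ (W q)) hWc fun q => ?_⟩
  rw [← app_res, hu, map_add, app_res, ht', res_res]
  exact (congrArg _ (hφ0 _ _)).trans (add_zero _)

end Lift

end CoarseSheaf

theorem mainTheorem10 (T : Type u) [MetricSpace T] (hT : CoarseSheaf.IsMetricTree T)
    (A : Type u) [AddCommGroup A] [Finite A] :
    Limits.IsZero (CoarseSheaf.coarseCohomology T A 1) := by
  let I : InjectiveResolution (CoarseSheaf.constSheaf T A) := injectiveResolution _
  let η : CoarseSheaf.constSheaf T A ⟶ I.cocomplex.X 0 := I.ι.f 0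
  have w : η ≫ I.cocomplex.d 0 1 = 0 := I.ι_f_zero_comp_complex_d
  have hex : (ShortComplex.mk η (I.cocomplex.d 0 1) w).Exact := I.exact₀
  have hη : Mono η := inferInstanceAs (Mono (I.ι.f 0))
  refine CoarseSheaf.isZero_rightDerived_one T I fun s hs => ?_
  have := CoarseSheaf.constPresheafMap_isLocallyInjective η
  exact (CoarseSheaf.IsMetricTree.isCoarselyAcyclic hT).exists_lift
    (I.cocomplex.X 0).property (I.cocomplex.X 1).property (CoarseSheaf.constPresheafMap η)
    (I.cocomplex.d 0 1).hom (CoarseSheaf.constPresheafMap_comp η w)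
    (fun U t ht => CoarseSheaf.imageSieve_constPresheafMap_mem η hex t ht) s
    (CoarseSheaf.imageSieve_mem_of_exact (I.exact_succ 0) s hs)
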